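/- Let $\Bbbk$ be a field. For a coalgebra $C$ over $\Bbbk$ (coassociative and counital), $\mathcal M^C$ denotes the category of right $C$-comodules and colinear maps, and $\mathcal M^C_f$ its full subcategory of finite-dimensional comodules. A morphism of coalgebras $\pi:H\to H'$ turns every $H$-comodule $V$, with coaction $v\mapsto v_0\otimes v_1$, into an $H'$-comodule with coaction $v\mapsto v_0\otimes\pi(v_1)$; this defines the corestriction functors $\mathcal M^H\to\mathcal M^{H'}$ and $\mathcal M^H_f\to\mathcal M^{H'}_f$, which are the identity on underlying linear maps. For a morphism $\pi:H\to H'$ of $\Bbbk$-coalgebras the following conditions are equivalent: (a) $\pi$ is a monomorphism in the category of $\Bbbk$-coalgebras; (b) the corestriction functor $\mathcal M^H\to\mathcal M^{H'}$ is full; (b$_f$) the corestriction functor $\mathcal M^H_f\to\mathcal M^{H'}_f$ is full; (c) for every $H$-comodule $V$, every idempotent $H'$-comodule endomorphism of $V$ is a morphism of $H$-comodules; (c$_f$) the same as (c) for every finite-dimensional $H$-comodule $V$; (d) for every $H$-comodule $V$, whenever $V=V_1\oplus V_2$ with $V_1,V_2$ being $H'$-subcomodules of $V$, both $V_1$ and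 $V_2$ are $H$-subcomodules of $V$; (d$_f$) the same as (d) for every finite-dimensional $H$-comodule $V$. If moreover $H$ and $H'$ are Hopf algebras and $\pi$ is a morphism of Hopf algebras, then all of these are also equivalent to each of the following: (e) for every right $H$-comodule $V$, the space $V^{H'}:=\{v\in V\mid v_0\otimes\pi(v_1)=v\otimes 1\}$ of $H'$-coinvariants equals the space $V^{H}:=\{v\in V\mid v_0\otimes v_1=v\otimes 1\}$ of $H$-coinvariants; (e$_f$) the same as (e) for every finite-dimensional right $H$-comodule $V$; (f) $H^{H'}=\Bbbk 1$, where $H$ is a right $H$-comodule through its comultiplication; that is, the only $h\in H$ with $h_1\otimes\pi(h_2)=h\otimes 1$ are the scalars. -/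

import Mathlib

open scoped TensorProduct
open CategoryTheory

universe u

/-- A right comodule over the `k`-coalgebra `C`: a `k`-vector space `V` with a coassociative and
counital coaction `V → V ⊗ C`. -/
structure Comod (k : Type u) [Field k] (C : Type u) [AddCommGroup C] [Module k C]
    [Coalgebra k C] where
  carrier : Type u
  [instAddCommGroup : AddCommGroup carrier]
  [instModule : Module k carrier]
  /-- The coaction `v ↦ v₀ ⊗ v₁`. -/
  coact : carrier →ₗ[k] carrier ⊗[k] C
  coassoc : TensorProduct.assoc k carrier C C ∘ₗ coact.rTensor C ∘ₗ coact =
    (Coalgebra.comul (R := k) (A := C)).lTensor carrier ∘ₗ coact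
  counital : (Coalgebra.counit (R := k) (A := C)).lTensor carrier ∘ₗ coact =
    (TensorProduct.mk k carrier k).flip 1

namespace Comod

attribute [instance] Comod.instAddCommGroup Comod.instModule

section Basic

variable {k : Type u} [Field k] {C : Type u} [AddCommGroup C] [Module k C] [Coalgebra k C]

instance : CoeSort (Comod k C) (Type u) := ⟨Comod.carrier⟩

/-- Morphisms of right comodules: the colinear maps. -/
@[ext]
structure Hom (V W : Comod k C) where
  toLinearMap : V →ₗ[k] W
  colinear : W.coact ∘ₗ toLinearMap = toLinearMap.rTensor C ∘ₗ V.coact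

/-- The category of right `C`-comodules. -/
instance category : Category (Comod k C) where
  Hom V W := Hom V W
  id V := ⟨LinearMap.id, by simp⟩
  comp f g := ⟨g.toLinearMap ∘ₗ f.toLinearMap, by
    rw [← LinearMap.comp_assoc, g.colinear, LinearMap.comp_assoc, f.colinear,
      ← LinearMap.comp_assoc, ← LinearMap.rTensor_comp]⟩

/-- A subspace `U` of a comodule `V` is a subcomodule if the coaction maps it to
`U ⊗ C ⊆ V ⊗ C`. -/
def IsSubcomodule (V : Comod k C) (U : Submodule k V) : Prop :=
  ∀ x ∈ U, V.coact x ∈ LinearMap.range (U.subtype.rTensor C)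

variable (k C) in
/-- The property of a comodule of being finite-dimensional over `k`. -/
def finDim : ObjectProperty (Comod k C) := fun V => FiniteDimensional k V

variable (k C) in
/-- The coalgebra `C` as a right comodule over itself, through its comultiplication. -/
abbrev regular : Comod k C where
  carrier := C
  coact := Coalgebra.comul
  coassoc := Coalgebra.coassoc
  counital := Coalgebra.lTensor_counit_comp_comul

end Basic

section Corestriction

variable {k : Type u} [Field k] {H H' : Type u} [AddCommGroup H] [Module k H] [Coalgebra k H]
  [AddCommGroup H'] [Module k H'] [Coalgebra k H']

/-- The `H'`-comodule obtained from an `H`-comodule `V` along a coalgebra morphism `π : H → H'`: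
the same space with the coaction `v ↦ v₀ ⊗ π(v₁)`. -/
abbrev corestrict (π : H →ₗc[k] H') (V : Comod k H) : Comod k H' where
  carrier := V
  coact := π.toLinearMap.lTensor V ∘ₗ V.coact
  coassoc := by
    have h1 : (π.toLinearMap.lTensor V ∘ₗ V.coact).rTensor H' ∘ₗ π.toLinearMap.lTensor V =
        TensorProduct.map (π.toLinearMap.lTensor V) π.toLinearMap ∘ₗ V.coact.rTensor H := by
      ext x y; simp
    have h2 : (TensorProduct.assoc k V H' H').toLinearMap ∘ₗ
          TensorProduct.map (π.toLinearMap.lTensor V) π.toLinearMap =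
        (TensorProduct.map π.toLinearMap π.toLinearMap).lTensor V ∘ₗ
          (TensorProduct.assoc k V H H).toLinearMap := by
      ext x y z; simp
    calc (TensorProduct.assoc k V H' H').toLinearMap ∘ₗ
          (π.toLinearMap.lTensor V ∘ₗ V.coact).rTensor H' ∘ₗ π.toLinearMap.lTensor V ∘ₗ V.coact
        = ((TensorProduct.assoc k V H' H').toLinearMap ∘ₗ
          ((π.toLinearMap.lTensor V ∘ₗ V.coact).rTensor H' ∘ₗ π.toLinearMap.lTensor V)) ∘ₗ
            V.coact := rfl
      _ = (((TensorProduct.assoc k V H' H').toLinearMap ∘ₗ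
          TensorProduct.map (π.toLinearMap.lTensor V) π.toLinearMap) ∘ₗ V.coact.rTensor H) ∘ₗ
            V.coact := by rw [h1]; rfl
      _ = (TensorProduct.map π.toLinearMap π.toLinearMap).lTensor V ∘ₗ
          ((TensorProduct.assoc k V H H).toLinearMap ∘ₗ V.coact.rTensor H ∘ₗ V.coact) := by
            rw [h2]; rfl
      _ = (TensorProduct.map π.toLinearMap π.toLinearMap ∘ₗ Coalgebra.comul).lTensor V ∘ₗ
            V.coact := by
            rw [V.coassoc, ← LinearMap.comp_assoc, ← LinearMap.lTensor_comp]
      _ = (Coalgebra.comul.lTensor V) ∘ₗ π.toLinearMap.lTensor V ∘ₗ V.coact := by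
            rw [π.map_comp_comul, LinearMap.lTensor_comp, LinearMap.comp_assoc]
  counital := by
    rw [← LinearMap.comp_assoc, ← LinearMap.lTensor_comp, π.counit_comp, V.counital]

/-- The corestriction functor induced by a coalgebra morphism; it is the identity on maps. -/
def corestriction (π : H →ₗc[k] H') : Comod k H ⥤ Comod k H' where
  obj V := corestrict π V
  map {V W} f := ⟨f.toLinearMap, by
    have h : f.toLinearMap.rTensor H' ∘ₗ π.toLinearMap.lTensor V =
        π.toLinearMap.lTensor W ∘ₗ f.toLinearMap.rTensor H := by
      ext x y; simp
    calc (π.toLinearMap.lTensor W ∘ₗ W.coact) ∘ₗ f.toLinearMap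
        = π.toLinearMap.lTensor W ∘ₗ (f.toLinearMap.rTensor H ∘ₗ V.coact) := by
          rw [LinearMap.comp_assoc, f.colinear]
      _ = f.toLinearMap.rTensor H' ∘ₗ (π.toLinearMap.lTensor V ∘ₗ V.coact) := by
          rw [← LinearMap.comp_assoc, ← h, LinearMap.comp_assoc]⟩

/-- The corestriction functor between the categories of finite-dimensional comodules. -/
def corestrictionFin (π : H →ₗc[k] H') :
    (finDim k H).FullSubcategory ⥤ (finDim k H').FullSubcategory :=
  (finDim k H').lift ((finDim k H).ι ⋙ corestriction π) (fun V => V.property)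

/-- Every idempotent `H'`-comodule endomorphism of the `H`-comodule `V` is a morphism of
`H`-comodules. -/
def IdempotentsLift (π : H →ₗc[k] H') (V : Comod k H) : Prop :=
  ∀ e : (corestriction π).obj V ⟶ (corestriction π).obj V, e ≫ e = e →
    ∃ e' : V ⟶ V, (corestriction π).map e' = e

/-- Every decomposition of the `H`-comodule `V` as an internal direct sum of two
`H'`-subcomodules is one into `H`-subcomodules. -/
def DecompositionsLift (π : H →ₗc[k] H') (V : Comod k H) : Prop :=
  ∀ V₁ V₂ : Submodule k V, IsCompl V₁ V₂ →
    (corestrict π V).IsSubcomodule V₁ → (corestrict π V).IsSubcomodule V₂ →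
    V.IsSubcomodule V₁ ∧ V.IsSubcomodule V₂

end Corestriction

section Coinvariants

variable {k : Type u} [Field k] {H : Type u} [Ring H] [Bialgebra k H]

/-- The coinvariants `{v | v₀ ⊗ v₁ = v ⊗ 1}` of a right comodule over a bialgebra. -/
def coinvariants (V : Comod k H) : Submodule k V :=
  LinearMap.eqLocus V.coact ((TensorProduct.mk k V H).flip 1)

end Coinvariants

end Comod

/-! Fullness of corestriction says that every `H'`-colinear map `f : V → W` of `H`-comodules is
`H`-colinear (`ColinearLifts`). Two block-matrix tricks on `V ⊕ W` reduce this to special maps: the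
idempotent `(v, w) ↦ (v, f v)` reduces it to idempotents, hence to decompositions, and the shear
`(v, w) ↦ (v, w + f v)` reduces it to automorphisms. Since comodules are locally finite,
finite-dimensional comodules suffice.

If `π` is mono, write a finite-dimensional comodule in a basis: its coaction becomes a matrix of
coefficients, that is, a coalgebra morphism from a comatrix coalgebra to `H`. An isomorphism is
colinear exactly when the coefficient matrices in corresponding bases agree
(`isColinear_equiv_iff`). For an `H'`-colinear isomorphism the two morphisms agree after `π`, hence
agree already in `H`. Conversely, if `π ∘ f = π ∘ g` for `f, g : C → H`, the identity of `C` is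
`H'`-colinear between the `H`-comodules that `f` and `g` put on `C`; fullness makes it `H`-colinear,
and the counit of `C` gives `f = g`.

In the Hopf case, coinvariants are colinear maps out of the trivial comodule, so fullness implies
(e). Local finiteness carries (e_f) to the regular comodule, which gives (f). Finally, if `π ∘ f = π
∘ g`, the convolution quotient `f * g⁻¹` takes values in `H^{H'}`; under (f) these are scalars, the
counit shows that `f * g⁻¹` is trivial, and so `f = g`. -/

namespace Comod

/-! ### Colinear maps, idempotents and direct sums. -/

section Colinear

variable {k : Type u} [Field k] {C : Type u} [AddCommGroup C] [Module k C] [Coalgebra k C]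

/-- A linear map between comodules is colinear if it commutes with the coactions. -/
def IsColinear (V W : Comod k C) (f : V →ₗ[k] W) : Prop :=
  W.coact ∘ₗ f = f.rTensor C ∘ₗ V.coact

theorem isColinear_iff {V W : Comod k C} {f : V →ₗ[k] W} :
    IsColinear V W f ↔ ∀ v, W.coact (f v) = f.rTensor C (V.coact v) :=
  LinearMap.ext_iff

theorem isColinear_id (V : Comod k C) : IsColinear V V LinearMap.id := by
  simp [IsColinear]

theorem IsColinear.comp {U V W : Comod k C} {g : V →ₗ[k] W} {f : U →ₗ[k] V}
    (hg : IsColinear V W g) (hf : IsColinear U V f) : IsColinear U W (g ∘ₗ f) := by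
  rw [isColinear_iff] at *
  intro v
  rw [LinearMap.comp_apply, hg, hf, LinearMap.rTensor_comp_apply]

theorem IsColinear.add {V W : Comod k C} {f g : V →ₗ[k] W}
    (hf : IsColinear V W f) (hg : IsColinear V W g) : IsColinear V W (f + g) := by
  rw [isColinear_iff] at *
  intro v
  rw [LinearMap.rTensor_add, LinearMap.add_apply, LinearMap.add_apply, map_add, hf, hg]

theorem IsColinear.sub {V W : Comod k C} {f g : V →ₗ[k] W}
    (hf : IsColinear V W f) (hg : IsColinear V W g) : IsColinear V W (f - g) := by
  rw [isColinear_iff] at *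
  intro v
  rw [LinearMap.rTensor_sub, LinearMap.sub_apply, LinearMap.sub_apply, map_sub, hf, hg]

/-- Colinearity can be tested after composition with an injective colinear map. -/
theorem IsColinear.of_comp {U V W : Comod k C} {i : V →ₗ[k] W} {f : U →ₗ[k] V}
    (hi : IsColinear V W i) (inj : Function.Injective i) (h : IsColinear U W (i ∘ₗ f)) :
    IsColinear U V f := by
  rw [isColinear_iff] at *
  intro u
  apply Module.Flat.rTensor_preserves_injective_linearMap (M := C) i inj
  rw [← hi, ← LinearMap.rTensor_comp_apply, ← h, LinearMap.comp_apply]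

/-- The range of a colinear map is a subcomodule. -/
theorem IsColinear.isSubcomodule_range {V W : Comod k C} {f : V →ₗ[k] W}
    (hf : IsColinear V W f) : W.IsSubcomodule (LinearMap.range f) := by
  rintro _ ⟨v, rfl⟩
  rw [isColinear_iff.1 hf]
  refine ⟨f.rangeRestrict.rTensor C (V.coact v), ?_⟩
  rw [← LinearMap.rTensor_comp_apply]
  rfl

/-- An idempotent endomorphism is colinear exactly if its range and its kernel are
subcomodules. -/
theorem isColinear_iff_of_isIdempotentElem {V : Comod k C} {e : V →ₗ[k] V}
    (he : IsIdempotentElem e) :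
    IsColinear V V e ↔
      V.IsSubcomodule (LinearMap.range e) ∧ V.IsSubcomodule (LinearMap.ker e) := by
  have hee (v : V) : e (e v) = e v := LinearMap.congr_fun he v
  constructor
  · intro h
    refine ⟨h.isSubcomodule_range, ?_⟩
    have hk : LinearMap.ker e = LinearMap.range (LinearMap.id - e) := by
      ext v
      constructor
      · intro hv
        exact ⟨v, by simp [LinearMap.mem_ker.1 hv]⟩
      · rintro ⟨w, rfl⟩
        simp [hee]
    rw [hk]
    exact ((isColinear_id V).sub h).isSubcomodule_range
  · rintro ⟨hr, hk⟩
    rw [isColinear_iff]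
    intro v
    -- `e ⊗ id` fixes `range e ⊗ C` and kills `ker e ⊗ C`; apply this to the two parts of `v = e v +
    -- (v - e v)`.
    have h1 : e.rTensor C (V.coact (e v)) = V.coact (e v) := by
      obtain ⟨t, ht⟩ := hr (e v) ⟨v, rfl⟩
      rw [← ht, ← LinearMap.rTensor_comp_apply]
      congr 2
      ext ⟨_, w, rfl⟩
      exact hee w
    have h2 : e.rTensor C (V.coact (v - e v)) = 0 := by
      obtain ⟨t, ht⟩ := hk (v - e v) (by simp [hee])
      rw [← ht, ← LinearMap.rTensor_comp_apply, LinearMap.comp_ker_subtype]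
      simp
    rw [map_sub, map_sub, h1, sub_eq_zero] at h2
    exact h2.symm

/-- The direct sum of two comodules. -/
abbrev prod (V W : Comod k C) : Comod k C where
  carrier := V × W
  coact := ((LinearMap.inl k V W).rTensor C ∘ₗ V.coact).coprod
    ((LinearMap.inr k V W).rTensor C ∘ₗ W.coact)
  coassoc := by
    -- Coassociativity of `ρ` holds on the image of any comodule whose coaction is intertwined with
    -- `ρ`; the two summands cover the sum.
    have key (U : Comod k C) (i : U →ₗ[k] V × W) (ρ : V × W →ₗ[k] (V × W) ⊗[k] C)
        (h : ρ ∘ₗ i = i.rTensor C ∘ₗ U.coact) :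
        (TensorProduct.assoc k (V × W) C C ∘ₗ ρ.rTensor C ∘ₗ ρ) ∘ₗ i =
          ((Coalgebra.comul (R := k) (A := C)).lTensor (V × W) ∘ₗ ρ) ∘ₗ i := by
      calc _ = TensorProduct.assoc k (V × W) C C ∘ₗ ρ.rTensor C ∘ₗ (ρ ∘ₗ i) := rfl
        _ = TensorProduct.assoc k (V × W) C C ∘ₗ (ρ ∘ₗ i).rTensor C ∘ₗ U.coact := by
          rw [h, ← LinearMap.comp_assoc U.coact, ← LinearMap.rTensor_comp, h]
        _ = i.rTensor (C ⊗[k] C) ∘ₗ (TensorProduct.assoc k U C C ∘ₗ U.coact.rTensor C ∘ₗ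
            U.coact) := by
          rw [h, LinearMap.rTensor_comp, ← LinearMap.comp_assoc, ← LinearMap.comp_assoc,
            ← LinearMap.comp_assoc, ← LinearMap.comp_assoc]
          congr 2
          ext; simp
        _ = (Coalgebra.comul (R := k) (A := C)).lTensor (V × W) ∘ₗ
            (i.rTensor C ∘ₗ U.coact) := by
          rw [U.coassoc, ← LinearMap.comp_assoc, ← LinearMap.comp_assoc,
            LinearMap.rTensor_comp_lTensor, LinearMap.lTensor_comp_rTensor]
        _ = _ := by rw [← h]; rfl
    apply LinearMap.prod_ext
    · exact key V _ _ (LinearMap.coprod_inl _ _)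
    · exact key W _ _ (LinearMap.coprod_inr _ _)
  counital := by
    have key (U : Comod k C) (i : U →ₗ[k] V × W) :
        (Coalgebra.counit (R := k) (A := C)).lTensor (V × W) ∘ₗ i.rTensor C ∘ₗ U.coact =
          (TensorProduct.mk k (V × W) k).flip 1 ∘ₗ i := by
      rw [← LinearMap.comp_assoc, LinearMap.lTensor_comp_rTensor,
        ← LinearMap.rTensor_comp_lTensor, LinearMap.comp_assoc, U.counital]
      ext; simp
    apply LinearMap.prod_ext
    · rw [LinearMap.comp_assoc, LinearMap.coprod_inl, key]
    · rw [LinearMap.comp_assoc, LinearMap.coprod_inr, key]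

theorem isColinear_inl (V W : Comod k C) : IsColinear V (V.prod W) (LinearMap.inl k V W) :=
  LinearMap.coprod_inl _ _

theorem isColinear_inr (V W : Comod k C) : IsColinear W (V.prod W) (LinearMap.inr k V W) :=
  LinearMap.coprod_inr _ _

theorem isColinear_fst (V W : Comod k C) : IsColinear (V.prod W) V (LinearMap.fst k V W) := by
  apply LinearMap.prod_ext
  · calc V.coact ∘ₗ LinearMap.fst k V W ∘ₗ LinearMap.inl k V W
        = (LinearMap.fst k V W ∘ₗ LinearMap.inl k V W).rTensor C ∘ₗ V.coact := by
          rw [LinearMap.fst_comp_inl]; simp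
      _ = (LinearMap.fst k V W).rTensor C ∘ₗ (V.prod W).coact ∘ₗ LinearMap.inl k V W := by
          rw [isColinear_inl V W, LinearMap.rTensor_comp]; rfl
  · calc V.coact ∘ₗ LinearMap.fst k V W ∘ₗ LinearMap.inr k V W
        = (LinearMap.fst k V W ∘ₗ LinearMap.inr k V W).rTensor C ∘ₗ W.coact := by
          rw [LinearMap.fst_comp_inr]; simp
      _ = (LinearMap.fst k V W).rTensor C ∘ₗ (V.prod W).coact ∘ₗ LinearMap.inr k V W := by
          rw [isColinear_inr V W, LinearMap.rTensor_comp]; rfl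

theorem isColinear_snd (V W : Comod k C) : IsColinear (V.prod W) W (LinearMap.snd k V W) := by
  apply LinearMap.prod_ext
  · calc W.coact ∘ₗ LinearMap.snd k V W ∘ₗ LinearMap.inl k V W
        = (LinearMap.snd k V W ∘ₗ LinearMap.inl k V W).rTensor C ∘ₗ V.coact := by
          rw [LinearMap.snd_comp_inl]; simp
      _ = (LinearMap.snd k V W).rTensor C ∘ₗ (V.prod W).coact ∘ₗ LinearMap.inl k V W := by
          rw [isColinear_inl V W, LinearMap.rTensor_comp]; rfl
  · calc W.coact ∘ₗ LinearMap.snd k V W ∘ₗ LinearMap.inr k V W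
        = (LinearMap.snd k V W ∘ₗ LinearMap.inr k V W).rTensor C ∘ₗ W.coact := by
          rw [LinearMap.snd_comp_inr]; simp
      _ = (LinearMap.snd k V W).rTensor C ∘ₗ (V.prod W).coact ∘ₗ LinearMap.inr k V W := by
          rw [isColinear_inr V W, LinearMap.rTensor_comp]; rfl

end Colinear

end Comod

namespace Comod

/-! ### Subcomodules and local finiteness. -/

section Contraction

variable {k : Type u} [Field k] {C : Type u} [AddCommGroup C] [Module k C]

/-- The contraction `v ⊗ c ↦ φ(c) v`. -/
noncomputable def contract (V : Type u) [AddCommGroup V] [Module k V] (φ : Module.Dual k C) :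
    V ⊗[k] C →ₗ[k] V :=
  (TensorProduct.rid k V).toLinearMap ∘ₗ φ.lTensor V

@[simp]
theorem contract_tmul (V : Type u) [AddCommGroup V] [Module k V] (φ : Module.Dual k C) (v : V)
    (c : C) : contract V φ (v ⊗ₜ c) = φ c • v := by
  simp [contract]

/-- A tensor lies in `U ⊗ C` if all its contractions lie in `U`. -/
theorem mem_range_rTensor_subtype (V : Type u) [AddCommGroup V] [Module k V]
    (U : Submodule k V) (t : V ⊗[k] C) (h : ∀ φ : Module.Dual k C, contract V φ t ∈ U) :
    t ∈ LinearMap.range (U.subtype.rTensor C) := by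
  classical
  -- By exactness it suffices that `t` vanishes in `(V ⧸ U) ⊗ C`, and coordinates along a basis of
  -- `C` detect this.
  rw [← rTensor_mkQ, LinearMap.mem_ker]
  let b := Module.Basis.ofVectorSpace k C
  apply (TensorProduct.equivFinsuppOfBasisRight b).injective
  ext i
  rw [TensorProduct.equivFinsuppOfBasisRight_apply, map_zero, Finsupp.zero_apply]
  have hc : (TensorProduct.rid k (V ⧸ U)).toLinearMap ∘ₗ (b.coord i).lTensor (V ⧸ U) ∘ₗ
      U.mkQ.rTensor C = U.mkQ ∘ₗ contract V (b.coord i) := by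
    ext; simp
  refine (LinearMap.congr_fun hc t).trans ?_
  simpa using h (b.coord i)

end Contraction

section Subcomodule

variable {k : Type u} [Field k] {C : Type u} [AddCommGroup C] [Module k C] [Coalgebra k C]

/-- The inclusion `U ⊗ C → V ⊗ C` as an equivalence onto its range. -/
noncomputable def rTensorSubtypeEquiv (V : Comod k C) (U : Submodule k V) :
    U ⊗[k] C ≃ₗ[k] LinearMap.range (U.subtype.rTensor C) :=
  LinearEquiv.ofInjective _
    (Module.Flat.rTensor_preserves_injective_linearMap (M := C) _ U.injective_subtype)

/-- The coaction of a subcomodule. -/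
noncomputable def subCoact (V : Comod k C) (U : Submodule k V) (hU : V.IsSubcomodule U) :
    U →ₗ[k] U ⊗[k] C :=
  (V.rTensorSubtypeEquiv U).symm.toLinearMap ∘ₗ
    (V.coact ∘ₗ U.subtype).codRestrict _ fun x => hU x x.2

theorem rTensor_comp_subCoact (V : Comod k C) (U : Submodule k V) (hU : V.IsSubcomodule U) :
    U.subtype.rTensor C ∘ₗ V.subCoact U hU = V.coact ∘ₗ U.subtype := by
  ext x
  exact congrArg Subtype.val ((V.rTensorSubtypeEquiv U).apply_symm_apply
    ⟨V.coact x, hU x x.2⟩)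

/-- A subcomodule as a comodule. -/
noncomputable abbrev sub (V : Comod k C) (U : Submodule k V) (hU : V.IsSubcomodule U) :
    Comod k C where
  carrier := U
  coact := V.subCoact U hU
  coassoc := by
    have h := V.rTensor_comp_subCoact U hU
    apply LinearMap.cancel_left (Module.Flat.rTensor_preserves_injective_linearMap
      (M := C ⊗[k] C) _ U.injective_subtype) |>.1
    calc U.subtype.rTensor (C ⊗[k] C) ∘ₗ (TensorProduct.assoc k U C C).toLinearMap ∘ₗ
          (V.subCoact U hU).rTensor C ∘ₗ V.subCoact U hU
        = (TensorProduct.assoc k V C C).toLinearMap ∘ₗ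
          (U.subtype.rTensor C ∘ₗ V.subCoact U hU).rTensor C ∘ₗ V.subCoact U hU := by
          rw [LinearMap.rTensor_comp, ← LinearMap.comp_assoc, ← LinearMap.comp_assoc,
            ← LinearMap.comp_assoc, ← LinearMap.comp_assoc]
          congr 2
          ext; simp
      _ = (TensorProduct.assoc k V C C ∘ₗ V.coact.rTensor C ∘ₗ V.coact) ∘ₗ U.subtype := by
          rw [h, LinearMap.rTensor_comp, LinearMap.comp_assoc, h]; rfl
      _ = (Coalgebra.comul (R := k) (A := C)).lTensor V ∘ₗ
          (U.subtype.rTensor C ∘ₗ V.subCoact U hU) := by rw [V.coassoc, h]; rfl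
      _ = _ := by
          rw [← LinearMap.comp_assoc, ← LinearMap.comp_assoc, LinearMap.rTensor_comp_lTensor,
            LinearMap.lTensor_comp_rTensor]
  counital := by
    have h := V.rTensor_comp_subCoact U hU
    apply LinearMap.cancel_left (Module.Flat.rTensor_preserves_injective_linearMap
      (M := k) _ U.injective_subtype) |>.1
    rw [← LinearMap.comp_assoc, LinearMap.rTensor_comp_lTensor,
      ← LinearMap.lTensor_comp_rTensor, LinearMap.comp_assoc, h, ← LinearMap.comp_assoc,
      V.counital]
    ext; simp

theorem isColinear_subtype (V : Comod k C) (U : Submodule k V) (hU : V.IsSubcomodule U) :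
    IsColinear (V.sub U hU) V U.subtype :=
  (V.rTensor_comp_subCoact U hU).symm

theorem IsSubcomodule.sup {V : Comod k C} {U₁ U₂ : Submodule k V} (h₁ : V.IsSubcomodule U₁)
    (h₂ : V.IsSubcomodule U₂) : V.IsSubcomodule (U₁ ⊔ U₂) := by
  have mono {U : Submodule k V} (hle : U ≤ U₁ ⊔ U₂) (hU : V.IsSubcomodule U) (x : V)
      (hx : x ∈ U) : V.coact x ∈ LinearMap.range ((U₁ ⊔ U₂).subtype.rTensor C) := by
    obtain ⟨t, ht⟩ := hU x hx
    refine ⟨(Submodule.inclusion hle).rTensor C t, ?_⟩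
    rw [← ht, ← LinearMap.rTensor_comp_apply]
    rfl
  intro x hx
  obtain ⟨a, ha, b, hb, rfl⟩ := Submodule.mem_sup.1 hx
  rw [map_add]
  exact add_mem (mono le_sup_left h₁ a ha) (mono le_sup_right h₂ b hb)

/-- The action of `φ ∈ C*` on a comodule, `v ↦ φ(v₁) v₀`. -/
noncomputable def dualAct (V : Comod k C) (φ : Module.Dual k C) : V →ₗ[k] V :=
  contract V φ ∘ₗ V.coact

theorem dualAct_counit (V : Comod k C) (v : V) : V.dualAct Coalgebra.counit v = v := by
  have := LinearMap.congr_fun V.counital v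
  simp only [LinearMap.comp_apply, LinearMap.flip_apply, TensorProduct.mk_apply] at this
  simp [dualAct, contract, this]

/-- Coassociativity turns a comodule into a module over the convolution algebra `C*`. Hence the
orbit `C* v` is stable under the action. -/
theorem dualAct_dualAct (V : Comod k C) (φ ψ : Module.Dual k C) (v : V) :
    V.dualAct ψ (V.dualAct φ v) =
      V.dualAct (LinearMap.mul' k k ∘ₗ TensorProduct.map ψ φ ∘ₗ Coalgebra.comul) v := by
  have h1 : V.coact ∘ₗ contract V φ = (TensorProduct.rid k (V ⊗[k] C)).toLinearMap ∘ₗ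
      φ.lTensor (V ⊗[k] C) ∘ₗ V.coact.rTensor C := by ext; simp
  have h2 : contract V ψ ∘ₗ (TensorProduct.rid k (V ⊗[k] C)).toLinearMap ∘ₗ
      φ.lTensor (V ⊗[k] C) = contract V (LinearMap.mul' k k ∘ₗ TensorProduct.map ψ φ) ∘ₗ
        (TensorProduct.assoc k V C C).toLinearMap := by
    ext v c d
    simpa [mul_smul] using smul_comm (φ d) (ψ c) v
  calc V.dualAct ψ (V.dualAct φ v)
      = (contract V ψ ∘ₗ (V.coact ∘ₗ contract V φ) ∘ₗ V.coact) v := rfl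
    _ = ((contract V ψ ∘ₗ (TensorProduct.rid k (V ⊗[k] C)).toLinearMap ∘ₗ
          φ.lTensor (V ⊗[k] C)) ∘ₗ V.coact.rTensor C ∘ₗ V.coact) v := by rw [h1]; rfl
    _ = (contract V (LinearMap.mul' k k ∘ₗ TensorProduct.map ψ φ) ∘ₗ
          (TensorProduct.assoc k V C C ∘ₗ V.coact.rTensor C ∘ₗ V.coact)) v := by rw [h2]; rfl
    _ = _ := by
      rw [V.coassoc]
      simp only [dualAct, contract, LinearMap.lTensor_comp, LinearMap.comp_apply]

/-- Every element of a comodule lies in a finite-dimensional subcomodule. -/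
theorem exists_finiteDimensional_isSubcomodule_mem (V : Comod k C) (v : V) :
    ∃ U : Submodule k V, V.IsSubcomodule U ∧ FiniteDimensional k U ∧ v ∈ U := by
  let a : Module.Dual k C →ₗ[k] V :=
    { toFun φ := V.dualAct φ v
      map_add' φ ψ := by simp [dualAct, contract, LinearMap.lTensor_add]
      map_smul' c φ := by simp [dualAct, contract, LinearMap.lTensor_smul] }
  -- The subcomodule is the orbit `C* v`; the counit shows that it contains `v`.
  refine ⟨LinearMap.range a, ?_, ?_, ⟨Coalgebra.counit, V.dualAct_counit v⟩⟩
  · rintro _ ⟨φ, rfl⟩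
    apply mem_range_rTensor_subtype
    intro ψ
    exact ⟨_, (V.dualAct_dualAct φ ψ v).symm⟩
  -- A single tensor `V.coact v` involves only a finite-dimensional space `J` of left factors, and
  -- every contraction of it stays in `J`.
  · obtain ⟨J, hJ, y, hy⟩ := Submodule.exists_fg_le_eq_rTensor_subtype (V.coact v)
    have : FiniteDimensional k J := Module.Finite.iff_fg.2 hJ
    refine Submodule.finiteDimensional_of_le (S₂ := J) ?_
    rintro _ ⟨φ, rfl⟩
    have hc : contract V φ ∘ₗ J.subtype.rTensor C = J.subtype ∘ₗ contract J φ := by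
      ext; simp
    have : a φ = contract J φ y := by
      refine Eq.trans ?_ (LinearMap.congr_fun hc y)
      simp [a, dualAct, hy]
    rw [this]
    exact Subtype.prop _

/-- Every finite-dimensional subspace of a comodule lies in a finite-dimensional subcomodule. -/
theorem exists_finiteDimensional_isSubcomodule_le (V : Comod k C) (N : Submodule k V)
    (hN : N.FG) :
    ∃ U : Submodule k V, V.IsSubcomodule U ∧ FiniteDimensional k U ∧ N ≤ U := by
  induction N, hN using Submodule.fg_induction with
  | singleton x =>
    obtain ⟨U, hU, hf, hx⟩ := V.exists_finiteDimensional_isSubcomodule_mem x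
    exact ⟨U, hU, hf, by simpa using hx⟩
  | sup N₁ N₂ _ _ h₁ h₂ =>
    obtain ⟨U₁, hU₁, hf₁, hx₁⟩ := h₁
    obtain ⟨U₂, hU₂, hf₂, hx₂⟩ := h₂
    exact ⟨U₁ ⊔ U₂, hU₁.sup hU₂, inferInstance, sup_le_sup hx₁ hx₂⟩

end Subcomodule

end Comod

/-! ### Comatrix coalgebras and matrix coefficients. -/

/-- The comatrix coalgebra, with basis `E i j` and comultiplication
`E i j ↦ ∑ l, E i l ⊗ E l j`. -/
def Comatrix (k : Type u) [Field k] (n : Type) : Type u := n × n →₀ k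

namespace Comatrix

variable (k : Type u) [Field k] (n : Type)

noncomputable instance : AddCommGroup (Comatrix k n) :=
  inferInstanceAs (AddCommGroup (n × n →₀ k))

noncomputable instance : Module k (Comatrix k n) :=
  inferInstanceAs (Module k (n × n →₀ k))

/-- The standard basis of the comatrix coalgebra. -/
noncomputable def basis : Module.Basis (n × n) k (Comatrix k n) :=
  Module.Basis.ofRepr (LinearEquiv.refl k (n × n →₀ k))

variable [Fintype n] [DecidableEq n]

noncomputable instance : CoalgebraStruct k (Comatrix k n) where
  comul := (basis k n).constr k fun p => ∑ l, basis k n (p.1, l) ⊗ₜ[k] basis k n (l, p.2)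
  counit := (basis k n).constr k fun p => if p.1 = p.2 then 1 else 0

theorem comul_basis (i j : n) : Coalgebra.comul (R := k) (basis k n (i, j)) =
    ∑ l, basis k n (i, l) ⊗ₜ[k] basis k n (l, j) :=
  (basis k n).constr_basis k _ _

theorem counit_basis (i j : n) : Coalgebra.counit (R := k) (basis k n (i, j)) =
    if i = j then 1 else 0 :=
  (basis k n).constr_basis k _ _

noncomputable instance : Coalgebra k (Comatrix k n) where
  coassoc := by
    refine (basis k n).ext fun ⟨i, j⟩ => ?_
    simp only [LinearMap.comp_apply, comul_basis, map_sum, LinearMap.rTensor_tmul,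
      LinearMap.lTensor_tmul, TensorProduct.sum_tmul, TensorProduct.tmul_sum,
      LinearEquiv.coe_coe, TensorProduct.assoc_tmul]
    exact Finset.sum_comm
  rTensor_counit_comp_comul := by
    refine (basis k n).ext fun ⟨i, j⟩ => ?_
    simp [comul_basis, counit_basis, TensorProduct.ite_tmul]
  lTensor_counit_comp_comul := by
    refine (basis k n).ext fun ⟨i, j⟩ => ?_
    simp [comul_basis, counit_basis, TensorProduct.tmul_ite]

end Comatrix

namespace Comod

section Coefficients

variable {k : Type u} [Field k] {C : Type u} [AddCommGroup C] [Module k C] [Coalgebra k C]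
  {n : Type}

/-- The contraction `v ⊗ c ↦ φ(v) c`. -/
noncomputable def contractLeft {V : Type u} [AddCommGroup V] [Module k V]
    (D : Type u) [AddCommGroup D] [Module k D] (φ : Module.Dual k V) : V ⊗[k] D →ₗ[k] D :=
  (TensorProduct.lid k D).toLinearMap ∘ₗ φ.rTensor D

@[simp]
theorem contractLeft_tmul {V : Type u} [AddCommGroup V] [Module k V]
    (D : Type u) [AddCommGroup D] [Module k D] (φ : Module.Dual k V) (v : V) (d : D) :
    contractLeft D φ (v ⊗ₜ d) = φ v • d := by
  simp [contractLeft]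

theorem eq_sum_tmul_contractLeft [Fintype n] {V : Type u} [AddCommGroup V] [Module k V]
    (D : Type u) [AddCommGroup D] [Module k D] (b : Module.Basis n k V) (t : V ⊗[k] D) :
    t = ∑ i, b i ⊗ₜ[k] contractLeft D (b.coord i) t := by
  induction t with
  | zero => simp
  | tmul v d =>
    conv_lhs => rw [← b.sum_repr v]
    simp only [TensorProduct.sum_tmul, TensorProduct.smul_tmul, contractLeft_tmul,
      Module.Basis.coord_apply]
  | add x y hx hy =>
    conv_lhs => rw [hx, hy]
    simp [TensorProduct.tmul_add, Finset.sum_add_distrib]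

/-- The matrix coefficients of a comodule with respect to a basis. -/
noncomputable def coeff (V : Comod k C) (b : Module.Basis n k V) (i j : n) : C :=
  contractLeft C (b.coord i) (V.coact (b j))

variable [Fintype n]

theorem coact_basis (V : Comod k C) (b : Module.Basis n k V) (j : n) :
    V.coact (b j) = ∑ i, b i ⊗ₜ[k] V.coeff b i j :=
  eq_sum_tmul_contractLeft C b _

variable [DecidableEq n]

theorem counit_coeff (V : Comod k C) (b : Module.Basis n k V) (i j : n) :
    Coalgebra.counit (R := k) (V.coeff b i j) = if i = j then 1 else 0 := by
  have h := congrArg (contractLeft k (b.coord i)) (LinearMap.congr_fun V.counital (b j))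
  simp only [LinearMap.comp_apply, V.coact_basis b, map_sum, LinearMap.lTensor_tmul,
    contractLeft_tmul, LinearMap.flip_apply, TensorProduct.mk_apply] at h
  simpa [Finsupp.single_apply, eq_comm] using h

/-- This is the coefficient of `b i` in coassociativity evaluated at `b j`; it makes `coeffHom`
comultiplicative. -/
theorem comul_coeff (V : Comod k C) (b : Module.Basis n k V) (i j : n) :
    Coalgebra.comul (R := k) (V.coeff b i j) =
      ∑ l, V.coeff b i l ⊗ₜ[k] V.coeff b l j := by
  have h := congrArg (contractLeft (C ⊗[k] C) (b.coord i))
    (LinearMap.congr_fun V.coassoc (b j))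
  simp only [LinearMap.comp_apply, V.coact_basis b, map_sum, LinearMap.lTensor_tmul,
    LinearMap.rTensor_tmul, TensorProduct.sum_tmul, LinearEquiv.coe_coe,
    TensorProduct.assoc_tmul, contractLeft_tmul] at h
  simpa [Finsupp.single_apply] using h.symm

/-- The coalgebra morphism from the comatrix coalgebra given by the matrix coefficients. -/
noncomputable def coeffHom (V : Comod k C) (b : Module.Basis n k V) :
    Comatrix k n →ₗc[k] C where
  toLinearMap := (Comatrix.basis k n).constr k fun p => V.coeff b p.1 p.2
  counit_comp := by
    refine (Comatrix.basis k n).ext fun ⟨i, j⟩ => ?_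
    simp [counit_coeff, Comatrix.counit_basis]
  map_comp_comul := by
    refine (Comatrix.basis k n).ext fun ⟨i, j⟩ => ?_
    simp [comul_coeff, Comatrix.comul_basis]

theorem coeffHom_basis (V : Comod k C) (b : Module.Basis n k V) (i j : n) :
    V.coeffHom b (Comatrix.basis k n (i, j)) = V.coeff b i j :=
  (Comatrix.basis k n).constr_basis k _ _

/-- A linear isomorphism is colinear if and only if the matrix coefficients in corresponding
bases agree. -/
theorem isColinear_equiv_iff (V W : Comod k C) (b : Module.Basis n k V) (e : V ≃ₗ[k] W) :
    IsColinear V W e.toLinearMap ↔ ∀ i j, W.coeff (b.map e) i j = V.coeff b i j := by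
  constructor
  · intro h i j
    rw [isColinear_iff] at h
    have := congrArg (contractLeft C ((b.map e).coord i)) (h (b j))
    rw [V.coact_basis b] at this
    simpa [coeff, Finsupp.single_apply] using this
  · intro h
    refine b.ext fun j => ?_
    have := W.coact_basis (b.map e) j
    simp only [Module.Basis.map_apply, h] at this
    simp [this, V.coact_basis b]

end Coefficients

end Comod

/-! ### Convolution and coalgebra morphisms into a Hopf algebra. -/

namespace LinearMap

open WithConv

variable {k : Type u} [Field k] {A B : Type u} [Ring A] [Algebra k A] [Ring B] [Algebra k B]
  {C D : Type u} [AddCommGroup C] [Module k C] [Coalgebra k C]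
  [AddCommGroup D] [Module k D] [Coalgebra k D]

variable (C) in
/-- Composition with an algebra morphism, as a morphism of convolution monoids. -/
noncomputable def convPostcomp (φ : A →ₐ[k] B) :
    WithConv (C →ₗ[k] A) →* WithConv (C →ₗ[k] B) where
  toFun f := toConv (φ.toLinearMap ∘ₗ f.ofConv)
  map_one' := by
    apply WithConv.ext
    ext
    simp [convOne_def]
  map_mul' f g := WithConv.ext (algHom_comp_convMul_distrib φ f g)

variable (A) in
/-- Composition with a coalgebra morphism, as a morphism of convolution monoids. -/
noncomputable def convPrecomp (f : C →ₗc[k] D) :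
    WithConv (D →ₗ[k] A) →* WithConv (C →ₗ[k] A) where
  toFun g := toConv (g.ofConv ∘ₗ f.toLinearMap)
  map_one' := by
    apply WithConv.ext
    ext
    simp [convOne_def]
  map_mul' g h := WithConv.ext (convMul_comp_coalgHom_distrib g h f)

end LinearMap

namespace Comod

section Hopf

open WithConv LinearMap

variable {k : Type u} [Field k] {H : Type u} [Ring H] [HopfAlgebra k H]
  {C : Type u} [AddCommGroup C] [Module k C] [Coalgebra k C]

/-- A coalgebra morphism to a Hopf algebra as a unit for the convolution product. -/
noncomputable def convUnit (f : C →ₗc[k] H) : (WithConv (C →ₗ[k] H))ˣ :=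
  -- The identity of `H` is convolution-invertible with inverse the antipode; precomposing with `f`
  -- gives the inverse `S ∘ f` of `f`.
  Units.map (convPrecomp H f)
    ⟨toConv LinearMap.id, toConv (HopfAlgebra.antipode k), id_mul_antipode, antipode_mul_id⟩

variable {H' : Type u} [Ring H'] [HopfAlgebra k H']

/-- If the only `H'`-coinvariants in `H` are the scalars, then coalgebra morphisms to `H` that
agree after composition with `π` are equal. -/
theorem coalgHom_ext_of_coinvariants_regular (π : H →ₐc[k] H')
    (hπ : (corestrict (π : H →ₗc[k] H') (regular k H)).coinvariants =
      Submodule.span k {(1 : H)})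
    (f g : C →ₗc[k] H) (h : ∀ c, π (f c) = π (g c)) : f = g := by
  let π' : H →ₐ[k] H' := π
  let a : H →ₐ[k] H ⊗[k] H' :=
    (Algebra.TensorProduct.map (AlgHom.id k H) π').comp (Bialgebra.comulAlgHom k H)
  let i : H →ₐ[k] H ⊗[k] H' := Algebra.TensorProduct.includeLeft
  let j : H →ₐ[k] H ⊗[k] H' := (Algebra.TensorProduct.includeRight).comp π'
  -- Here `a h = h₁ ⊗ π(h₂)`, `i h = h ⊗ 1` and `j h = 1 ⊗ π(h)`. As `f` is comultiplicative, `a ∘ f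
  -- = (i ∘ f) * (j ∘ f)`.
  have split (f : C →ₗc[k] H) : Units.map (convPostcomp C a) (convUnit f) =
      Units.map (convPostcomp C i) (convUnit f) * Units.map (convPostcomp C j) (convUnit f) := by
    apply Units.ext
    apply WithConv.ext
    have h1 : LinearMap.mul' k (H ⊗[k] H') ∘ₗ
        TensorProduct.map (i.toLinearMap ∘ₗ f.toLinearMap) (j.toLinearMap ∘ₗ f.toLinearMap) =
        (Algebra.TensorProduct.map (AlgHom.id k H) π').toLinearMap ∘ₗ
          TensorProduct.map f.toLinearMap f.toLinearMap := by
      ext; simp [i, j]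
    change a.toLinearMap ∘ₗ f.toLinearMap = LinearMap.mul' k (H ⊗[k] H') ∘ₗ
        TensorProduct.map (i.toLinearMap ∘ₗ f.toLinearMap) (j.toLinearMap ∘ₗ f.toLinearMap) ∘ₗ
          Coalgebra.comul
    rw [← LinearMap.comp_assoc, h1, LinearMap.comp_assoc, f.map_comp_comul]
    rfl
  have hj : Units.map (convPostcomp C j) (convUnit f) =
      Units.map (convPostcomp C j) (convUnit g) := by
    apply Units.ext
    apply WithConv.ext
    ext c
    exact congrArg (fun x => (1 : H) ⊗ₜ[k] x) (h c)
  have hε (f : C →ₗc[k] H) :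
      Units.map (convPostcomp C (Bialgebra.counitAlgHom k H)) (convUnit f) = 1 := by
    apply Units.ext
    apply WithConv.ext
    exact f.counit_comp
  set T := convUnit f * (convUnit g)⁻¹ with hT
  -- In `a(f) * a(g)⁻¹` the inner factors `j(f) * j(g)⁻¹` cancel, which leaves `i(f) * i(g)⁻¹`: the
  -- values of `T` are `H'`-coinvariant.
  have hcoinv : Units.map (convPostcomp C a) T = Units.map (convPostcomp C i) T := by
    rw [hT, map_mul, map_mul, map_inv, map_inv, split, split, hj]
    group
  have hcounit : Units.map (convPostcomp C (Bialgebra.counitAlgHom k H)) T = 1 := by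
    rw [hT, map_mul, map_inv, hε, hε]
    group
  -- Each value `T c` is now a scalar, and `hcounit` identifies that scalar as `ε(c)`.
  have hone : T = 1 := by
    apply Units.ext
    apply WithConv.ext
    ext c
    have hc : T.val.ofConv c ∈
        (corestrict (π : H →ₗc[k] H') (regular k H)).coinvariants :=
      congrArg (fun u : (WithConv (C →ₗ[k] H ⊗[k] H'))ˣ => u.val.ofConv c) hcoinv
    rw [hπ, Submodule.mem_span_singleton] at hc
    obtain ⟨r, hr⟩ := hc
    have hr' : Coalgebra.counit (R := k) (T.val.ofConv c) = Coalgebra.counit (R := k) c :=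
      congrArg (fun u : (WithConv (C →ₗ[k] k))ˣ => u.val.ofConv c) hcounit
    rw [← hr] at hr' ⊢
    simp only [map_smul, Bialgebra.counit_one, smul_eq_mul, mul_one] at hr'
    rw [hr']
    exact (Algebra.algebraMap_eq_smul_one _).symm
  have hfg : convUnit f = convUnit g := mul_inv_eq_one.1 hone
  have := congrArg (fun u : (WithConv (C →ₗ[k] H))ˣ => u.val.ofConv) hfg
  ext c
  exact LinearMap.congr_fun this c

end Hopf

end Comod

namespace Comod

/-! ### Monomorphisms, fullness and idempotents for coalgebras. -/

section Corestriction

variable {k : Type u} [Field k] {H H' : Type u} [AddCommGroup H] [Module k H] [Coalgebra k H]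
  [AddCommGroup H'] [Module k H'] [Coalgebra k H']

theorem IsColinear.corestrict (π : H →ₗc[k] H') {V W : Comod k H} {f : V →ₗ[k] W}
    (hf : IsColinear V W f) : IsColinear (corestrict π V) (corestrict π W) f :=
  ((corestriction π).map (X := V) (Y := W) ⟨f, hf⟩).colinear

/-- Every `H'`-colinear map between the `H`-comodules `V` and `W` is `H`-colinear. -/
def ColinearLifts (π : H →ₗc[k] H') (V W : Comod k H) : Prop :=
  ∀ f : V →ₗ[k] W, IsColinear (corestrict π V) (corestrict π W) f → IsColinear V W f

theorem full_corestriction_iff (π : H →ₗc[k] H') :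
    (corestriction π).Full ↔ ∀ V W : Comod k H, ColinearLifts π V W := by
  constructor
  · intro _ V W f hf
    obtain ⟨g, hg⟩ := (corestriction π).map_surjective (X := V) (Y := W) ⟨f, hf⟩
    have : g.toLinearMap = f := congrArg Hom.toLinearMap hg
    exact this ▸ g.colinear
  · intro h
    exact ⟨fun {V W} f => ⟨⟨f.toLinearMap, h V W _ f.colinear⟩, rfl⟩⟩

theorem full_corestrictionFin_iff (π : H →ₗc[k] H') :
    (corestrictionFin π).Full ↔ ∀ V W : Comod k H, FiniteDimensional k V →
      FiniteDimensional k W → ColinearLifts π V W := by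
  constructor
  · intro _ V W hV hW f hf
    let V' : (finDim k H).FullSubcategory := ⟨V, hV⟩
    let W' : (finDim k H).FullSubcategory := ⟨W, hW⟩
    let f' : (corestrictionFin π).obj V' ⟶ (corestrictionFin π).obj W' :=
      ObjectProperty.homMk ⟨f, hf⟩
    obtain ⟨g, hg⟩ := (corestrictionFin π).map_surjective f'
    have : g.hom.toLinearMap = f := congrArg (fun m => m.hom.toLinearMap) hg
    exact this ▸ g.hom.colinear
  · intro h
    exact ⟨fun {V W} f => ⟨ObjectProperty.homMk
      ⟨f.hom.toLinearMap, h V.obj W.obj V.property W.property _ f.hom.colinear⟩, rfl⟩⟩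

theorem idempotentsLift_iff (π : H →ₗc[k] H') (V : Comod k H) :
    IdempotentsLift π V ↔ ∀ e : V →ₗ[k] V, IsIdempotentElem e →
      IsColinear (corestrict π V) (corestrict π V) e → IsColinear V V e := by
  constructor
  · intro h e he hc
    obtain ⟨g, hg⟩ := h ⟨e, hc⟩ (Hom.ext he)
    have : g.toLinearMap = e := congrArg Hom.toLinearMap hg
    exact this ▸ g.colinear
  · intro h e he
    exact ⟨⟨e.toLinearMap, h _ (congrArg Hom.toLinearMap he) e.colinear⟩, rfl⟩

/-- Idempotents correspond to decompositions through range and kernel, and the subcomodule criterion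
for colinearity applies over both `H` and `H'`. -/
theorem idempotentsLift_iff_decompositionsLift (π : H →ₗc[k] H') (V : Comod k H) :
    IdempotentsLift π V ↔ DecompositionsLift π V := by
  rw [idempotentsLift_iff]
  constructor
  · intro h V₁ V₂ hc h₁ h₂
    have he := Submodule.isIdempotentElem_projection hc
    have := h _ he ((isColinear_iff_of_isIdempotentElem (V := corestrict π V) he).2
      (by rw [Submodule.range_projection, Submodule.ker_projection]; exact ⟨h₁, h₂⟩))
    rwa [isColinear_iff_of_isIdempotentElem he, Submodule.range_projection,
      Submodule.ker_projection] at this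
  · intro h e he hc
    rw [isColinear_iff_of_isIdempotentElem he]
    obtain ⟨h₁, h₂⟩ := (isColinear_iff_of_isIdempotentElem (V := corestrict π V) he).1 hc
    exact h _ _ (LinearMap.IsIdempotentElem.isCompl he) h₁ h₂

theorem ColinearLifts.idempotentsLift {π : H →ₗc[k] H'} {V : Comod k H}
    (h : ColinearLifts π V V) : IdempotentsLift π V :=
  (idempotentsLift_iff π V).2 fun e _ => h e

/-- A map `f : V → W` gives the idempotent `(v, w) ↦ (v, f v)` of `V × W`. -/
theorem colinearLifts_of_idempotentsLift_prod {π : H →ₗc[k] H'} {V W : Comod k H}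
    (h : IdempotentsLift π (V.prod W)) : ColinearLifts π V W := by
  intro f hf
  rw [idempotentsLift_iff] at h
  let e : V × W →ₗ[k] V × W := LinearMap.inl k V W ∘ₗ LinearMap.fst k V W +
    LinearMap.inr k V W ∘ₗ f ∘ₗ LinearMap.fst k V W
  have he : IsIdempotentElem e := by
    ext <;> simp [e]
  have hi := (isColinear_inl V W).corestrict π
  have hr := (isColinear_inr V W).corestrict π
  have hp := (isColinear_fst V W).corestrict π
  have hc := h e he ((hi.comp hp).add (hr.comp (hf.comp hp)))
  have hfe : f = LinearMap.snd k V W ∘ₗ e ∘ₗ LinearMap.inl k V W := by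
    ext; simp [e]
  rw [hfe]
  exact (isColinear_snd V W).comp (hc.comp (isColinear_inl V W))

/-- By local finiteness, it suffices to lift colinear maps between finite-dimensional
comodules. -/
theorem colinearLifts_of_finiteDimensional {π : H →ₗc[k] H'}
    (h : ∀ V W : Comod k H, FiniteDimensional k V → FiniteDimensional k W → ColinearLifts π V W)
    (V W : Comod k H) : ColinearLifts π V W := by
  intro f hf
  rw [isColinear_iff]
  intro v
  obtain ⟨V₀, hV₀, hfV, hv⟩ := V.exists_finiteDimensional_isSubcomodule_mem v
  -- The image of `V₀` is not yet known to be an `H`-subcomodule, so it is enlarged to one.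
  obtain ⟨W₀, hW₀, hfW, hle⟩ := W.exists_finiteDimensional_isSubcomodule_le (V₀.map f)
    ((Module.Finite.iff_fg.1 hfV).map f)
  let f₀ : V₀ →ₗ[k] W₀ := f.restrict fun x hx => hle (Submodule.mem_map_of_mem hx)
  have hV := V.isColinear_subtype V₀ hV₀
  have hW := W.isColinear_subtype W₀ hW₀
  have hf₀ : IsColinear (V.sub V₀ hV₀) (W.sub W₀ hW₀) f₀ :=
    h (V.sub V₀ hV₀) (W.sub W₀ hW₀) hfV hfW f₀
      (IsColinear.of_comp (U := corestrict π (V.sub V₀ hV₀)) (hW.corestrict π)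
        W₀.injective_subtype (hf.comp (hV.corestrict π)))
  have hcomp : IsColinear (V.sub V₀ hV₀) W (f ∘ₗ V₀.subtype) := hW.comp hf₀
  have h1 := isColinear_iff.1 hcomp ⟨v, hv⟩
  have h2 := isColinear_iff.1 hV ⟨v, hv⟩
  rw [LinearMap.rTensor_comp_apply, ← h2] at h1
  exact h1

theorem mono_ofHom_iff (π : H →ₗc[k] H') :
    Mono (CoalgCat.ofHom π) ↔ ∀ (C : Type u) [AddCommGroup C] [Module k C] [Coalgebra k C]
      (f g : C →ₗc[k] H), (∀ c, π (f c) = π (g c)) → f = g := by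
  constructor
  · intro _ C _ _ _ f g h
    have : CoalgCat.ofHom f = CoalgCat.ofHom g := by
      rw [← cancel_mono (CoalgCat.ofHom π)]
      exact CoalgCat.Hom.ext (DFunLike.ext _ _ h)
    exact congrArg CoalgCat.Hom.toCoalgHom' this
  · intro h
    refine ⟨fun {C} f g hfg => CoalgCat.Hom.ext (h C f.toCoalgHom' g.toCoalgHom' fun c => ?_)⟩
    exact DFunLike.congr_fun (congrArg CoalgCat.Hom.toCoalgHom' hfg) c

/-- Corestricting the regular comodule of `C` along `f` and `g` gives two `H`-coactions on `C` which
coincide over `H'`. Lifting the identity makes them equal, and `(ε ⊗ id)` applied to `c₁ ⊗ f(c₂)`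
returns `f c`. -/
theorem mono_of_colinearLifts {π : H →ₗc[k] H'} (h : ∀ V W : Comod k H, ColinearLifts π V W) :
    Mono (CoalgCat.ofHom π) := by
  rw [mono_ofHom_iff]
  intro C _ _ _ f g hfg
  have hc : (corestrict π (corestrict f (regular k C))).coact =
      (corestrict π (corestrict g (regular k C))).coact := by
    have : π.toLinearMap ∘ₗ f.toLinearMap = π.toLinearMap ∘ₗ g.toLinearMap :=
      LinearMap.ext hfg
    change π.toLinearMap.lTensor C ∘ₗ f.toLinearMap.lTensor C ∘ₗ Coalgebra.comul =
      π.toLinearMap.lTensor C ∘ₗ g.toLinearMap.lTensor C ∘ₗ Coalgebra.comul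
    rw [← LinearMap.comp_assoc, ← LinearMap.comp_assoc, ← LinearMap.lTensor_comp,
      ← LinearMap.lTensor_comp, this]
  have hid := h (corestrict f (regular k C)) (corestrict g (regular k C)) LinearMap.id (by
    rw [isColinear_iff]
    intro v
    rw [LinearMap.rTensor_id, hc]
    rfl)
  have key (f : C →ₗc[k] H) (c : C) : (TensorProduct.lid k H) ((Coalgebra.counit (R := k)).rTensor H
      (f.toLinearMap.lTensor C (Coalgebra.comul (R := k) c))) = f c := by
    rw [← LinearMap.comp_apply (LinearMap.rTensor H _), LinearMap.rTensor_comp_lTensor,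
      ← LinearMap.lTensor_comp_rTensor, LinearMap.comp_apply,
      Coalgebra.rTensor_counit_comul]
    simp
  ext c
  have := isColinear_iff.1 hid c
  rw [LinearMap.rTensor_id] at this
  rw [← key f, ← key g]
  exact congrArg (fun t => TensorProduct.lid k H ((Coalgebra.counit (R := k)).rTensor H t))
    this.symm

/-- Along a monomorphism, `H'`-colinear isomorphisms of finite-dimensional comodules are
`H`-colinear. -/
theorem isColinear_equiv_of_mono {π : H →ₗc[k] H'} (hπ : Mono (CoalgCat.ofHom π))
    {V W : Comod k H} [FiniteDimensional k V] (e : V ≃ₗ[k] W)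
    (he : IsColinear (corestrict π V) (corestrict π W) e.toLinearMap) :
    IsColinear V W e.toLinearMap := by
  rw [mono_ofHom_iff] at hπ
  let b := Module.finBasis k V
  have hcoeff {ι : Type} (U : Comod k H) (b : Module.Basis ι k U) (i j : ι) :
      (corestrict π U).coeff b i j = π (U.coeff b i j) := by
    have : contractLeft H' (b.coord i) ∘ₗ π.toLinearMap.lTensor U =
        π.toLinearMap ∘ₗ contractLeft H (b.coord i) := by
      ext; simp
    exact LinearMap.congr_fun this (U.coact (b j))
  have heq := (isColinear_equiv_iff (corestrict π V) (corestrict π W) b e).1 he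
  -- The comatrix coalgebra is the test object: its two morphisms to `H` agree after `π` because `e`
  -- is `H'`-colinear.
  have hhom : W.coeffHom (b.map e) = V.coeffHom b := by
    refine hπ _ _ _ fun c => ?_
    have : π.toLinearMap ∘ₗ (W.coeffHom (b.map e)).toLinearMap =
        π.toLinearMap ∘ₗ (V.coeffHom b).toLinearMap := by
      refine (Comatrix.basis k _).ext fun ⟨i, j⟩ => ?_
      change π (W.coeffHom (b.map e) _) = π (V.coeffHom b _)
      rw [coeffHom_basis, coeffHom_basis, ← hcoeff, ← hcoeff]
      exact heq i j
    exact LinearMap.congr_fun this c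
  rw [isColinear_equiv_iff V W b e]
  intro i j
  rw [← coeffHom_basis, ← coeffHom_basis, hhom]

/-- A map `f : V → W` gives the automorphism `(v, w) ↦ (v, w + f v)` of `V × W`. -/
theorem colinearLifts_of_mono {π : H →ₗc[k] H'} (hπ : Mono (CoalgCat.ofHom π))
    (V W : Comod k H) [FiniteDimensional k V] [FiniteDimensional k W] : ColinearLifts π V W := by
  intro f hf
  let n : V × W →ₗ[k] V × W := LinearMap.inr k V W ∘ₗ f ∘ₗ LinearMap.fst k V W
  -- Since `n ∘ n = 0`, the maps `id + n` and `id - n` are mutually inverse.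
  let e : (V × W) ≃ₗ[k] V × W := LinearEquiv.ofLinearMap (LinearMap.id + n) (LinearMap.id - n)
    (by ext <;> simp [n]) (by ext <;> simp [n])
  have hi := (isColinear_inl V W).corestrict π
  have hr := (isColinear_inr V W).corestrict π
  have hp := (isColinear_fst V W).corestrict π
  have he : IsColinear (corestrict π (V.prod W)) (corestrict π (V.prod W)) e.toLinearMap :=
    (isColinear_id _).add (hr.comp (hf.comp hp))
  have hc := isColinear_equiv_of_mono hπ (V := V.prod W) (W := V.prod W) e he
  have hfe : f = LinearMap.snd k V W ∘ₗ e.toLinearMap ∘ₗ LinearMap.inl k V W := by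
    ext; simp [e, n]
  rw [hfe]
  exact (isColinear_snd V W).comp (hc.comp (isColinear_inl V W))

theorem tfae_mono (π : H →ₗc[k] H') : List.TFAE [
    Mono (CoalgCat.ofHom π),
    (corestriction π).Full,
    (corestrictionFin π).Full,
    ∀ V : Comod k H, IdempotentsLift π V,
    ∀ V : Comod k H, FiniteDimensional k V → IdempotentsLift π V,
    ∀ V : Comod k H, DecompositionsLift π V,
    ∀ V : Comod k H, FiniteDimensional k V → DecompositionsLift π V] := by
  simp only [full_corestriction_iff, full_corestrictionFin_iff,
    ← idempotentsLift_iff_decompositionsLift]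
  tfae_have 1 → 3 := fun h V W _ _ => colinearLifts_of_mono h V W
  tfae_have 3 → 2 := colinearLifts_of_finiteDimensional
  tfae_have 2 → 1 := mono_of_colinearLifts
  tfae_have 2 → 4 := fun h V => (h V V).idempotentsLift
  tfae_have 4 → 5 := fun h V _ => h V
  tfae_have 5 → 3 := fun h V W _ _ =>
    colinearLifts_of_idempotentsLift_prod (h (V.prod W) inferInstance)
  tfae_have 4 ↔ 6 := Iff.rfl
  tfae_have 5 ↔ 7 := Iff.rfl
  tfae_finish

end Corestriction

/-! ### Coinvariants in the Hopf case. -/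

section Coinvariants

variable {k : Type u} [Field k] {H H' : Type u} [Ring H] [HopfAlgebra k H] [Ring H']
  [HopfAlgebra k H']

theorem mem_coinvariants {V : Comod k H} {v : V} :
    v ∈ V.coinvariants ↔ V.coact v = v ⊗ₜ[k] (1 : H) :=
  Iff.rfl

variable (k H) in
/-- The ground field as a comodule with the trivial coaction. -/
noncomputable abbrev trivial : Comod k H where
  carrier := k
  coact := (TensorProduct.mk k k H).flip 1
  coassoc := by ext; simp [Algebra.TensorProduct.one_def]
  counital := by ext; simp

theorem mem_coinvariants_corestrict (π : H →ₐc[k] H') {V : Comod k H} {v : V} :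
    v ∈ (corestrict (π : H →ₗc[k] H') V).coinvariants ↔
      (π : H →ₗc[k] H').toLinearMap.lTensor V (V.coact v) = v ⊗ₜ[k] (1 : H') :=
  Iff.rfl

theorem coinvariants_le_corestrict (π : H →ₐc[k] H') (V : Comod k H) :
    V.coinvariants ≤ (corestrict (π : H →ₗc[k] H') V).coinvariants := by
  intro v hv
  rw [mem_coinvariants_corestrict, mem_coinvariants.1 hv]
  simp

/-- A vector `v` is coinvariant exactly when `a ↦ a v` is colinear from the trivial comodule, so
lifting that map lifts coinvariance. -/
theorem coinvariants_corestrict_eq (π : H →ₐc[k] H') {V : Comod k H}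
    (h : ColinearLifts (π : H →ₗc[k] H') (trivial k H) V) :
    (corestrict (π : H →ₗc[k] H') V).coinvariants = V.coinvariants := by
  refine le_antisymm (fun v hv => ?_) (coinvariants_le_corestrict π V)
  have hc := h (LinearMap.toSpanSingleton k V v) (by
    rw [isColinear_iff]
    intro a
    rw [mem_coinvariants_corestrict] at hv
    simpa [TensorProduct.smul_tmul'] using congrArg (a • ·) hv)
  simpa [mem_coinvariants] using isColinear_iff.1 hc (1 : k)

/-- The regular comodule may be infinite-dimensional, so the hypothesis is applied to a
finite-dimensional subcomodule containing the given element. -/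
theorem coinvariants_corestrict_regular (π : H →ₐc[k] H')
    (h : ∀ V : Comod k H, FiniteDimensional k V →
      (corestrict (π : H →ₗc[k] H') V).coinvariants = V.coinvariants) :
    (corestrict (π : H →ₗc[k] H') (regular k H)).coinvariants =
      Submodule.span k {(1 : H)} := by
  apply le_antisymm
  · intro x hx
    obtain ⟨U, hU, hfin, hxU⟩ := (regular k H).exists_finiteDimensional_isSubcomodule_mem x
    have hi := (regular k H).isColinear_subtype U hU
    have hxU' : (⟨x, hxU⟩ : U) ∈ ((regular k H).sub U hU).coinvariants := by
      rw [← h _ hfin, mem_coinvariants_corestrict]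
      -- Coinvariance in `U` can be checked in `H ⊗ H'`, as `U ⊗ H'` embeds there.
      apply Module.Flat.rTensor_preserves_injective_linearMap (M := H') _ U.injective_subtype
      exact (isColinear_iff.1 (hi.corestrict (π : H →ₗc[k] H')) ⟨x, hxU⟩).symm.trans hx
    have hx' : Coalgebra.comul (R := k) x = x ⊗ₜ[k] (1 : H) := by
      refine (isColinear_iff.1 hi ⟨x, hxU⟩).trans ?_
      rw [mem_coinvariants.1 hxU']
      rfl
    -- The counit on the left factor of `x₁ ⊗ x₂ = x ⊗ 1` gives `x = ε(x) 1`.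
    have := congrArg (fun t => TensorProduct.lid k H ((Coalgebra.counit (R := k)).rTensor H t)) hx'
    simp only [Coalgebra.rTensor_counit_comul, LinearMap.rTensor_tmul, TensorProduct.lid_tmul,
      one_smul] at this
    rw [this]
    exact Submodule.smul_mem _ _ (Submodule.mem_span_singleton_self _)
  · rw [Submodule.span_singleton_le_iff_mem]
    apply coinvariants_le_corestrict
    exact Bialgebra.comul_one

end Coinvariants

end Comod

theorem mainTheorem1 (k : Type u) [Field k] :
    (∀ (H H' : Type u) [AddCommGroup H] [Module k H] [Coalgebra k H]
        [AddCommGroup H'] [Module k H'] [Coalgebra k H'] (π : H →ₗc[k] H'),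
      List.TFAE [
        Mono (CoalgCat.ofHom π),
        (Comod.corestriction π).Full,
        (Comod.corestrictionFin π).Full,
        ∀ V : Comod k H, Comod.IdempotentsLift π V,
        ∀ V : Comod k H, FiniteDimensional k V → Comod.IdempotentsLift π V,
        ∀ V : Comod k H, Comod.DecompositionsLift π V,
        ∀ V : Comod k H, FiniteDimensional k V → Comod.DecompositionsLift π V]) ∧
    (∀ (H H' : Type u) [Ring H] [HopfAlgebra k H] [Ring H'] [HopfAlgebra k H']
        (π : H →ₐc[k] H'),
      List.TFAE [
        Mono (CoalgCat.ofHom (π : H →ₗc[k] H')),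
        (Comod.corestriction (π : H →ₗc[k] H')).Full,
        (Comod.corestrictionFin (π : H →ₗc[k] H')).Full,
        ∀ V : Comod k H, Comod.IdempotentsLift (π : H →ₗc[k] H') V,
        ∀ V : Comod k H, FiniteDimensional k V → Comod.IdempotentsLift (π : H →ₗc[k] H') V,
        ∀ V : Comod k H, Comod.DecompositionsLift (π : H →ₗc[k] H') V,
        ∀ V : Comod k H, FiniteDimensional k V → Comod.DecompositionsLift (π : H →ₗc[k] H') V,
        ∀ V : Comod k H,
          (Comod.corestrict (π : H →ₗc[k] H') V).coinvariants = V.coinvariants,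
        ∀ V : Comod k H, FiniteDimensional k V →
          (Comod.corestrict (π : H →ₗc[k] H') V).coinvariants = V.coinvariants,
        (Comod.corestrict (π : H →ₗc[k] H') (Comod.regular k H)).coinvariants =
          Submodule.span k {(1 : H)}]) := by
  refine ⟨fun H H' _ _ _ _ _ _ π => Comod.tfae_mono π, fun H H' _ _ _ _ π => ?_⟩
  have h := Comod.tfae_mono (π : H →ₗc[k] H')
  tfae_have 1 ↔ 2 := h.out 0 1
  tfae_have 1 ↔ 3 := h.out 0 2
  tfae_have 1 ↔ 4 := h.out 0 3
  tfae_have 1 ↔ 5 := h.out 0 4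
  tfae_have 1 ↔ 6 := h.out 0 5
  tfae_have 1 ↔ 7 := h.out 0 6
  tfae_have 2 → 8 := fun hf V =>
    Comod.coinvariants_corestrict_eq π ((Comod.full_corestriction_iff _).1 hf _ V)
  tfae_have 8 → 9 := fun hc V _ => hc V
  tfae_have 9 → 10 := Comod.coinvariants_corestrict_regular π
  tfae_have 10 → 1 := fun hc => (Comod.mono_ofHom_iff _).2 fun _ _ _ _ f g =>
    Comod.coalgHom_ext_of_coinvariants_regular π hc f g
  tfae_finish
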